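/- Let $V$ be a finite set of $n$ users and let $E\subseteq V\times V$ be a set of directed links, each link $(u,v)\in E$ carrying a probability $p(u,v)\in[0,1]$. Each user $v$ has a criticality $cr_v\ge 0$, and $\Omega=\sum_{v\in V}cr_v>0$. Under the Independent Cascade model with seed set $S\subseteq V$, exactly the users of $S$ are activated in round $0$; in each round $t\ge 1$ every user $u$ activated in round $t-1$ makes one attempt on each not yet activated $v$ with $(u,v)\in E$, which succeeds with probability $p(u,v)$, independently of all other attempts; activated users stay activated, and the process stops when no new user is activated. Let $\mathbb I^c(S)$ be the expected total criticality of the users activated in this process. Let $1\le k\le n$, and let $S^*$ maximize $\mathbb I^c$ among the sets of exactly $k$ users. A random RR (reverse-reachable) set is generated as follows: choose an origin $v$ with probability $cr_v/\Omega$ and, independently, a sample graph in which each link $(u,w)\in E$ is kept independently with probability $p(u,w)$; the RR set consists of all users that can reach $v$ in the sample graph. It is covered by $S$ if it contains a user of $S$. A greedy maximum-coverage routine, applied to a list of RR sets, starts from $\emptyset$ and adds $k$ users one by one, each a not yet chosen user that covers as many of the yet uncovered RR sets as possible (ties are broken by any fixed rule). Let $\epsilon>0$ and $0<\delta<1$,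 and put $$\sigma=\sqrt{\ln\tfrac3\delta},\qquad \tau=\sqrt{\left(1-\tfrac1e\right)\left(\ln\tbinom nk+\ln\tfrac3\delta\right)},\qquad \phi=\frac{(1-1/e)\sigma+\tau}{\epsilon},\qquad \gamma=2\left(\phi^2+\ln\tfrac3\delta\right).$$ The algorithm Targeted-IM generates independent random RR sets, first $\lceil\gamma\rceil$ of them. It then runs the greedy maximum-coverage routine on all RR sets generated so far; if the resulting set $\bar S$ covers at least $\gamma$ of them, it stops and returns $\bar S$; otherwise it doubles the number of RR sets by generating new ones, and repeats. **Theorem 1.** With probability at least $1-\delta$, Targeted-IM stops and the returned seed set $\bar S$ satisfies $$\mathbb I^c(\bar S)\;\ge\;\left(1-\tfrac1e-\epsilon\right)\mathbb I^c(S^*).$$ -/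

import Mathlib

open MeasureTheory
open scoped NNReal ENNReal

/-- A social network on the user set `V`: directed links, each link `(u, v)` carrying a propagation
probability `p(u, v) ∈ [0, 1]` (values of `prob` off `links` play no role). -/
structure SocialNetwork (V : Type*) where
  links : Finset (V × V)
  prob : V × V → ℝ≥0
  prob_le_one : ∀ e ∈ links, prob e ≤ 1

namespace SocialNetwork

/-- Sets of users carry the discrete sigma-algebra. -/
instance instMeasurableSpaceFinset (V : Type*) : MeasurableSpace (Finset V) := ⊤

variable {V : Type*} [Fintype V] [DecidableEq V]

/-! ### Flipping the coins of the links -/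

/-- The probability that `L` is exactly the set of successful links, when every link succeeds
independently of the others with its own probability. -/
def coinWeight (G : SocialNetwork V) (L : Finset (V × V)) : ℝ≥0 :=
  if L ⊆ G.links then (∏ e ∈ L, G.prob e) * ∏ e ∈ G.links \ L, (1 - G.prob e) else 0

theorem sum_coinWeight {V : Type*} [DecidableEq V] (G : SocialNetwork V) :
    ∑ L ∈ G.links.powerset, G.coinWeight L = 1 := by
  have h : ∏ e ∈ G.links, (G.prob e + (1 - G.prob e)) = 1 :=
    Finset.prod_eq_one fun e he => add_tsub_cancel_of_le (G.prob_le_one e he)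
  rw [Finset.prod_add] at h
  rw [← h]
  refine Finset.sum_congr rfl fun L hL => ?_
  rw [coinWeight, if_pos (Finset.mem_powerset.mp hL)]

/-- One independent coin flip for every link: the law of the random set of successful links. -/
noncomputable def coins (G : SocialNetwork V) : PMF (Finset (V × V)) :=
  PMF.ofFinset (fun L => (G.coinWeight L : ℝ≥0∞)) G.links.powerset
    (by exact_mod_cast G.sum_coinWeight)
    (by
      intro L hL
      rw [Finset.mem_powerset] at hL
      simp [coinWeight, hL])

/-! ### The Independent Cascade model -/

/-- The state after a round of the Independent Cascade process: all users activated so far, and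
those among them who were activated in that very round. -/
abbrev CascadeState (V : Type*) := Finset V × Finset V

/-- Given that the links in `L` succeed, the not yet activated users who are activated by a user
that was activated in the previous round. -/
def newlyActive (s : CascadeState V) (L : Finset (V × V)) : Finset V :=
  {v | v ∉ s.1 ∧ ∃ u ∈ s.2, (u, v) ∈ L}

/-- One round: every user activated in the previous round makes a single attempt along each of its
links; all attempts are independent, with fresh coins in every round. -/
noncomputable def cascadeStep (G : SocialNetwork V) (s : CascadeState V) : PMF (CascadeState V) :=
  G.coins.map fun L => (s.1 ∪ newlyActive s L, newlyActive s L)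

/-- The law of the Independent Cascade process with seed set `S` after round `t`. -/
noncomputable def cascade (G : SocialNetwork V) (S : Finset V) : ℕ → PMF (CascadeState V)
  | 0 => PMF.pure (S, S)
  | t + 1 => (G.cascade S t).bind G.cascadeStep

/-- `𝕀ᶜ(S)`: the expected total criticality of the users that are influenced when `S` is the seed
set. Every round before the process stops activates a new user, so the process has always stopped
by round `|V|`. -/
noncomputable def expectedCriticality (G : SocialNetwork V) (cr : V → ℝ≥0) (S : Finset V) : ℝ :=
  ∑ s : CascadeState V, (G.cascade S (Fintype.card V) s).toReal * ∑ v ∈ s.1, (cr v : ℝ)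

/-- `S` is an optimal seed set of size `k`. -/
def IsOptimalSeedSet (G : SocialNetwork V) (cr : V → ℝ≥0) (k : ℕ) (S : Finset V) : Prop :=
  S.card = k ∧
    ∀ T : Finset V, T.card = k → G.expectedCriticality cr T ≤ G.expectedCriticality cr S

/-! ### Criticality-weighted reverse-reachable sets -/

/-- The law of the origin of a random RR set: `v` is chosen with probability `cr v / ∑ w, cr w`. -/
noncomputable def origin (cr : V → ℝ≥0) (hcr : 0 < ∑ v, cr v) : PMF V :=
  PMF.ofFintype (fun v => ((cr v / ∑ w, cr w : ℝ≥0) : ℝ≥0∞)) (by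
    rw [← ENNReal.ofNNReal_finsetSum, ← Finset.sum_div, div_self hcr.ne', ENNReal.coe_one])

open scoped Classical in
/-- The users that can reach `v` along links of the sample graph with link set `L`. -/
noncomputable def reverseReachable (L : Finset (V × V)) (v : V) : Finset V :=
  {u | Relation.ReflTransGen (fun a b => (a, b) ∈ L) u v}

/-- The law of a random RR set: the users that can reach a random origin in an independent random
sample graph, in which each link is kept with its propagation probability. -/
noncomputable def rrSet (G : SocialNetwork V) (cr : V → ℝ≥0) (hcr : 0 < ∑ v, cr v) :
    PMF (Finset V) :=
  (origin cr hcr).bind fun v => G.coins.map fun L => reverseReachable L v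

/-- The law of an infinite sequence of independent random RR sets. -/
noncomputable def rrSequence (G : SocialNetwork V) (cr : V → ℝ≥0) (hcr : 0 < ∑ v, cr v) :
    Measure (ℕ → Finset V) :=
  Measure.infinitePi fun _ : ℕ => (G.rrSet cr hcr).toMeasure

/-! ### Greedy maximum coverage -/

/-- The number of RR sets in the list `R` that are covered by `S`, i.e. contain a node of `S`. -/
def deg (R : List (Finset V)) (S : Finset V) : ℕ :=
  R.countP fun A => decide (A ∩ S).Nonempty

/-- `IsGreedy R k S`: the set `S` can be obtained from `∅` by `k` greedy steps, each of which adds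
a new node covering as many yet uncovered RR sets of `R` as possible (ties broken arbitrarily). -/
inductive IsGreedy (R : List (Finset V)) : ℕ → Finset V → Prop
  | zero : IsGreedy R 0 ∅
  | succ {j : ℕ} {S : Finset V} {v : V} (hS : IsGreedy R j S) (hv : v ∉ S)
      (hmax : ∀ w ∉ S, deg R (insert w S) ≤ deg R (insert v S)) :
      IsGreedy R (j + 1) (insert v S)

/-- `greedyMC` is an implementation of greedy maximum coverage with `k` nodes, with some rule for
breaking ties. -/
def IsGreedyMC (k : ℕ) (greedyMC : List (Finset V) → Finset V) : Prop :=
  ∀ R, IsGreedy R k (greedyMC R)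

/-! ### The algorithm Targeted-IM -/

/-- The stopping threshold `γ` for a network with `n` users. -/
noncomputable def threshold (n k : ℕ) (ε δ : ℝ) : ℝ :=
  let σ := √(Real.log (3 / δ))
  let τ := √((1 - 1 / Real.exp 1) * (Real.log (n.choose k) + Real.log (3 / δ)))
  let φ := ((1 - 1 / Real.exp 1) * σ + τ) / ε
  2 * (φ ^ 2 + Real.log (3 / δ))

/-- The RR sets available at check point `j`: the first `2 ^ j * ⌈γ⌉` sets of the sequence. -/
noncomputable def samples (γ : ℝ) (R : ℕ → Finset V) (j : ℕ) : List (Finset V) :=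
  (List.range (2 ^ j * ⌈γ⌉₊)).map R

/-- Targeted-IM, drawing its RR sets one after the other from the sequence `R`, halts and returns
the seed set `S`: at some check point the greedy solution `S` covers at least `γ` of the RR sets
drawn so far, and this happened at no earlier check point. -/
def TargetedIMReturns (γ : ℝ) (greedyMC : List (Finset V) → Finset V) (R : ℕ → Finset V)
    (S : Finset V) : Prop :=
  ∃ j : ℕ,
    (∀ i < j, (deg (samples γ R i) (greedyMC (samples γ R i)) : ℝ) < γ) ∧
    γ ≤ (deg (samples γ R j) (greedyMC (samples γ R j)) : ℝ) ∧
    S = greedyMC (samples γ R j)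

end SocialNetwork

/-! A cascade tries each link at most once, so all coins may be flipped in advance; then `v` gets
activated exactly when the set of users reaching `v` in the sample graph meets `S`. Averaging over
the origin gives 𝕀ᶜ(S) = Ω · p(S), where p(S) (`coverProb`) is the chance that a random RR set is
covered by `S` (`cascadeFrom_eq_map`, `expectedCriticality_eq`). It remains to compare cover
probabilities.

Write a = 1 - 1/e, q = p(S*), L = ln(3/δ). At every check point the greedy set covers at least a
times as many RR sets as S* (`IsGreedy.mul_deg_le`). A bad output therefore forces the event
`Misleading`: some k-set S with p(S) < (a - ε)q covers at least γ RR sets and at least a times as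
many as S*. The random stopping time and the dependence of the greedy set on the samples are
absorbed by union bounds over all check points and all k-sets, applied to Chernoff bounds for fixed
sets.

A check point with n RR sets is measured by x = nq/(2φ²). If x ≥ 1, the identity ε = aσ/φ + τ/φ
splits the error between underestimating S* and overestimating a bad set, and each half fails with
probability at most exp(-Lx). If x < 1, a bad set expects at most (a - ε)x · 2φ² covered RR sets but
must reach γ ≥ 2φ², which has probability at most exp(-4L)x. Since x doubles from one check point to
the next, the failure probabilities add up to at most 3exp(-L) = δ, however small the initial x is
(`sum_stageBound_le`). Finally, the coverage of S* almost surely reaches γ/a at some check point,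
which forces the algorithm to halt. -/

namespace SocialNetwork

variable {V : Type*} [Fintype V] [DecidableEq V]

/-! ### Live-edge description of the Independent Cascade model -/

/-- The probability that a single pair of users is (`b = true`) or is not a successful link. -/
def linkWeight (G : SocialNetwork V) (e : V × V) (b : Prop) [Decidable b] : ℝ≥0 :=
  if e ∈ G.links then (if b then G.prob e else 1 - G.prob e) else (if b then 0 else 1)

theorem coinWeight_eq_prod (G : SocialNetwork V) (L : Finset (V × V)) :
    G.coinWeight L = ∏ e, G.linkWeight e (e ∈ L) := by
  unfold coinWeight
  split_ifs with h
  · rw [← Finset.prod_subset (Finset.subset_univ G.links), ← Finset.prod_sdiff h, mul_comm]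
    · congr 1
      · refine Finset.prod_congr rfl fun e he => ?_
        rw [Finset.mem_sdiff] at he
        simp [linkWeight, he.1, he.2]
      · refine Finset.prod_congr rfl fun e he => ?_
        simp [linkWeight, he, h he]
    · intro e _ he
      have : e ∉ L := fun h' => he (h h')
      simp [linkWeight, he, this]
  · obtain ⟨e, heL, he⟩ := Finset.not_subset.mp h
    exact (Finset.prod_eq_zero (Finset.mem_univ e) (by simp [linkWeight, he, heL])).symm

/-- The links of `L` with source in `A`, together with the links of `L'` with source outside. -/
def splice (A : Finset V) (L L' : Finset (V × V)) : Finset (V × V) :=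
  {e | if e.1 ∈ A then e ∈ L else e ∈ L'}

theorem mem_splice {A : Finset V} {L L' : Finset (V × V)} {e : V × V} :
    e ∈ splice A L L' ↔ if e.1 ∈ A then e ∈ L else e ∈ L' := by
  simp [splice]

theorem splice_splice (A : Finset V) (L L' : Finset (V × V)) :
    splice A (splice A L L') (splice A L' L) = L := by
  ext e
  by_cases h : e.1 ∈ A <;> simp [mem_splice, h]

/-- The weight is a product over pairs of users, and splicing only exchanges the two factors at
pairs with source outside `A`. -/
theorem coinWeight_splice_mul (G : SocialNetwork V) (A : Finset V) (L L' : Finset (V × V)) :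
    G.coinWeight (splice A L L') * G.coinWeight (splice A L' L) =
      G.coinWeight L * G.coinWeight L' := by
  simp only [coinWeight_eq_prod, ← Finset.prod_mul_distrib]
  refine Finset.prod_congr rfl fun e _ => ?_
  by_cases h : e.1 ∈ A
  · simp [mem_splice, h]
  · simp [mem_splice, h, mul_comm]

/-- Resampling the coins of the links with source outside `A` does not change their law. -/
theorem coins_bind_map_splice (G : SocialNetwork V) (A : Finset V) :
    (G.coins.bind fun L => G.coins.map fun L' => splice A L L') = G.coins := by
  classical
  have key : ∀ F : Finset (V × V) → ℝ≥0∞,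
      ∑ x : Finset (V × V) × Finset (V × V), G.coins x.1 * G.coins x.2 * F (splice A x.1 x.2) =
        ∑ x : Finset (V × V) × Finset (V × V), G.coins x.1 * G.coins x.2 * F x.1 := by
    intro F
    -- This map is an involution preserving the product weight, so the spliced set has the law of
    -- the first coordinate.
    refine Finset.sum_bij' (fun x _ => (splice A x.1 x.2, splice A x.2 x.1))
      (fun x _ => (splice A x.1 x.2, splice A x.2 x.1)) ?_ ?_ ?_ ?_ ?_
    · simp
    · simp
    · simp [splice_splice]
    · simp [splice_splice]
    · intro x _
      refine congrArg (· * F _) ?_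
      simp only [show ∀ N, G.coins N = (G.coinWeight N : ℝ≥0∞) from fun _ => rfl]
      exact_mod_cast (G.coinWeight_splice_mul A x.1 x.2).symm
  ext M
  have h1 := key fun N => if M = N then 1 else 0
  rw [Fintype.sum_prod_type, Fintype.sum_prod_type] at h1
  simp only [PMF.bind_apply, PMF.map_apply, tsum_fintype, Finset.mul_sum]
  calc _ = _ := by
        refine Finset.sum_congr rfl fun L _ => Finset.sum_congr rfl fun L' _ => ?_
        by_cases h : M = splice A L L' <;> simp [h]
    _ = _ := h1
    _ = G.coins M := by
        have h2 : ∑ L', G.coins L' = 1 := by rw [← tsum_fintype (L := .unconditional _)]; exact G.coins.tsum_coe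
        simp only [mul_ite, mul_one, mul_zero]
        rw [Finset.sum_eq_single M]
        · simp [← Finset.mul_sum, h2]
        · intro b _ hb
          simp [hb.symm]
        · simp

/-- One round of the cascade when the successful links are those of `L`. -/
def spreadStep (L : Finset (V × V)) (s : CascadeState V) : CascadeState V :=
  (s.1 ∪ newlyActive s L, newlyActive s L)

theorem mem_newlyActive {s : CascadeState V} {L : Finset (V × V)} {v : V} :
    v ∈ newlyActive s L ↔ v ∉ s.1 ∧ ∃ u ∈ s.2, (u, v) ∈ L := by
  simp [newlyActive]

/-- The law of the cascade after `t` rounds, started from an arbitrary state. -/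
noncomputable def cascadeFrom (G : SocialNetwork V) : ℕ → CascadeState V → PMF (CascadeState V)
  | 0, s => PMF.pure s
  | t + 1, s => (G.cascadeStep s).bind (G.cascadeFrom t)

theorem cascadeFrom_succ_eq_bind (G : SocialNetwork V) (t : ℕ) (s : CascadeState V) :
    G.cascadeFrom (t + 1) s = (G.cascadeFrom t s).bind G.cascadeStep := by
  induction t generalizing s with
  | zero =>
    simp [cascadeFrom]
  | succ t ih =>
    rw [cascadeFrom, cascadeFrom, PMF.bind_bind]
    congr 1
    funext s'
    exact ih s'

theorem cascade_eq_cascadeFrom (G : SocialNetwork V) (S : Finset V) (t : ℕ) :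
    G.cascade S t = G.cascadeFrom t (S, S) := by
  induction t with
  | zero => rfl
  | succ t ih => rw [cascadeFrom_succ_eq_bind, cascade, ih]

theorem spreadStep_congr {s : CascadeState V} {L L' : Finset (V × V)}
    (h : ∀ e : V × V, e.1 ∈ s.2 → (e ∈ L ↔ e ∈ L')) : spreadStep L s = spreadStep L' s := by
  have : newlyActive s L = newlyActive s L' := by
    ext v
    simp only [mem_newlyActive]
    refine and_congr_right fun _ => exists_congr fun u => and_congr_right fun hu => h (u, v) hu
  simp [spreadStep, this]

/-- Users of `A` are already active and not in the frontier, so they never attempt again and their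
outgoing links are never read. -/
theorem iterate_spreadStep_congr {A : Finset V} {L L' : Finset (V × V)}
    (h : ∀ e : V × V, e.1 ∉ A → (e ∈ L ↔ e ∈ L')) (t : ℕ) (s : CascadeState V)
    (hA : A ⊆ s.1) (hs : ∀ v ∈ s.2, v ∉ A) : (spreadStep L)^[t] s = (spreadStep L')^[t] s := by
  induction t generalizing s with
  | zero => rfl
  | succ t ih =>
    rw [Function.iterate_succ_apply, Function.iterate_succ_apply,
      ← spreadStep_congr fun e he => h e (hs _ he)]
    refine ih _ (hA.trans Finset.subset_union_left) fun v hv hvA => ?_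
    exact (mem_newlyActive.mp hv).1 (hA hvA)

/-- The cascade with fresh coins in every round has the same law as the cascade in which all coins
are flipped once and for all in advance. -/
theorem cascadeFrom_eq_map (G : SocialNetwork V) (t : ℕ) (s : CascadeState V) (hs : s.2 ⊆ s.1) :
    G.cascadeFrom t s = G.coins.map fun L => (spreadStep L)^[t] s := by
  induction t generalizing s with
  | zero =>
    simp only [Function.iterate_zero, id]
    exact (PMF.map_const _ _).symm
  | succ t ih =>
    have h1 : G.cascadeFrom (t + 1) s =
        G.coins.bind fun L => G.coins.map fun L' => (spreadStep L')^[t] (spreadStep L s) := by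
      rw [cascadeFrom, show G.cascadeStep s = G.coins.map fun L => spreadStep L s from rfl,
        PMF.bind_map]
      congr 1
      funext L
      exact ih _ Finset.subset_union_right
    -- The first round reads only links with source in `s.2 ⊆ s.1`, later rounds only links with
    -- source outside `s.1`; one spliced set serves both.
    have h2 : ∀ L L' : Finset (V × V), (spreadStep L')^[t] (spreadStep L s) =
        (spreadStep (splice s.1 L L'))^[t + 1] s := by
      intro L L'
      have h3 : spreadStep L s = spreadStep (splice s.1 L L') s :=
        spreadStep_congr fun e he => by simp [mem_splice, hs he]
      rw [Function.iterate_succ_apply, ← h3]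
      refine iterate_spreadStep_congr (A := s.1) (fun e he => by simp [mem_splice, he]) t _
        Finset.subset_union_left fun v hv => (mem_newlyActive (L := L).mp hv).1
    rw [h1]
    simp only [h2]
    conv_rhs => rw [← G.coins_bind_map_splice s.1]
    rw [PMF.map_bind]
    simp only [PMF.map_comp]
    rfl

/-- The state of the cascade along fixed successful links: everything activated is reachable, users
activated before the last round have passed on their activation, and an active round means that
the process has activated a new user in every round. -/
theorem iterate_spreadStep_invariant (L : Finset (V × V)) (S : Finset V) (t : ℕ) :
    S ⊆ ((spreadStep L)^[t] (S, S)).1 ∧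
    (∀ v ∈ ((spreadStep L)^[t] (S, S)).1,
      ∃ u ∈ S, Relation.ReflTransGen (fun a b => (a, b) ∈ L) u v) ∧
    (∀ u ∈ ((spreadStep L)^[t] (S, S)).1, u ∉ ((spreadStep L)^[t] (S, S)).2 →
      ∀ v, (u, v) ∈ L → v ∈ ((spreadStep L)^[t] (S, S)).1) ∧
    ((spreadStep L)^[t] (S, S)).2 ⊆ ((spreadStep L)^[t] (S, S)).1 ∧
    (((spreadStep L)^[t] (S, S)).2.Nonempty → t < ((spreadStep L)^[t] (S, S)).1.card) := by
  induction t with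
  | zero =>
    refine ⟨subset_rfl, fun v hv => ⟨v, hv, .refl⟩, fun u hu hu' => absurd hu hu', subset_rfl,
      fun h => h.card_pos⟩
  | succ t ih =>
    rw [Function.iterate_succ_apply']
    generalize (spreadStep L)^[t] (S, S) = s at ih ⊢
    obtain ⟨h1, h2, h3, h4, h5⟩ := ih
    refine ⟨h1.trans Finset.subset_union_left, ?_, ?_, Finset.subset_union_right, ?_⟩
    · intro v hv
      rcases Finset.mem_union.mp hv with hv | hv
      · exact h2 v hv
      · obtain ⟨-, u, hu, huv⟩ := mem_newlyActive.mp hv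
        obtain ⟨w, hw, hwu⟩ := h2 u (h4 hu)
        exact ⟨w, hw, hwu.tail huv⟩
    · intro u hu hu' v huv
      rcases Finset.mem_union.mp hu with hu | hu
      · by_cases hu2 : u ∈ s.2
        · by_cases hv : v ∈ s.1
          · exact Finset.mem_union_left _ hv
          · exact Finset.mem_union_right _ (mem_newlyActive.mpr ⟨hv, u, hu2, huv⟩)
        · exact Finset.mem_union_left _ (h3 u hu hu2 v huv)
      · exact absurd hu hu'
    · rintro ⟨v, hv⟩
      obtain ⟨hv1, u, hu, huv⟩ := mem_newlyActive.mp hv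
      have hlt : s.1.card < (spreadStep L s).1.card :=
        Finset.card_lt_card ⟨Finset.subset_union_left, fun h =>
          hv1 (h (Finset.mem_union_right _ hv))⟩
      have := h5 ⟨u, hu⟩
      omega

theorem mem_iterate_spreadStep_card (L : Finset (V × V)) (S : Finset V) (v : V) :
    v ∈ ((spreadStep L)^[Fintype.card V] (S, S)).1 ↔ (reverseReachable L v ∩ S).Nonempty := by
  obtain ⟨h1, h2, h3, h4, h5⟩ := iterate_spreadStep_invariant L S (Fintype.card V)
  have hiff : (reverseReachable L v ∩ S).Nonempty ↔
      ∃ u ∈ S, Relation.ReflTransGen (fun a b => (a, b) ∈ L) u v := by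
    simp only [Finset.Nonempty, Finset.mem_inter, reverseReachable, Finset.mem_filter,
      Finset.mem_univ, true_and]
    exact exists_congr fun u => and_comm
  rw [hiff]
  refine ⟨h2 v, ?_⟩
  rintro ⟨u, hu, huv⟩
  -- A nonempty frontier at round `|V|` would mean more than `|V|` active users. With an empty
  -- frontier the active set is closed under links.
  have hempty : ((spreadStep L)^[Fintype.card V] (S, S)).2 = ∅ := by
    by_contra h
    exact absurd (h5 (Finset.nonempty_iff_ne_empty.mpr h)) (Finset.card_le_univ _).not_gt
  clear hiff
  induction huv with
  | refl => exact h1 hu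
  | tail _ hbc ih => exact h3 _ ih (by simp [hempty]) _ hbc

/-- The probability that a random RR set is covered by `S`. -/
noncomputable def coverProb (G : SocialNetwork V) (cr : V → ℝ≥0) (hcr : 0 < ∑ v, cr v)
    (S : Finset V) : ℝ :=
  (G.rrSet cr hcr).toMeasure.real {A | (A ∩ S).Nonempty}

theorem sum_map_toReal_mul {α β : Type*} [Fintype α] [Fintype β] (p : PMF α)
    (f : α → β) (F : β → ℝ) :
    ∑ b, (p.map f b).toReal * F b = ∑ a, (p a).toReal * F (f a) := by
  classical
  have h : ∀ b, (p.map f b).toReal = ∑ a, if b = f a then (p a).toReal else 0 := by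
    intro b
    rw [PMF.map_apply, tsum_fintype, ENNReal.toReal_sum]
    · refine Finset.sum_congr rfl fun a _ => ?_
      split_ifs <;> simp_all
    · intro a _
      split_ifs
      · exact p.apply_ne_top a
      · simp
  simp only [h, Finset.sum_mul]
  rw [Finset.sum_comm]
  refine Finset.sum_congr rfl fun a _ => ?_
  simp

theorem expectedCriticality_eq_sum (G : SocialNetwork V) (cr : V → ℝ≥0) (S : Finset V) :
    G.expectedCriticality cr S =
      ∑ L, (G.coins L).toReal *
        ∑ v, if (reverseReachable L v ∩ S).Nonempty then (cr v : ℝ) else 0 := by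
  classical
  unfold expectedCriticality
  rw [cascade_eq_cascadeFrom, cascadeFrom_eq_map _ _ _ subset_rfl,
    sum_map_toReal_mul _ _ fun s : CascadeState V => ∑ v ∈ s.1, (cr v : ℝ)]
  refine Finset.sum_congr rfl fun L _ => ?_
  simp only [← mem_iterate_spreadStep_card, Finset.sum_ite_mem, Finset.univ_inter]

theorem toReal_bind_apply {α β : Type*} [Fintype α] (p : PMF α) (f : α → PMF β) (b : β) :
    (p.bind f b).toReal = ∑ a, (p a).toReal * (f a b).toReal := by
  rw [PMF.bind_apply, tsum_fintype, ENNReal.toReal_sum]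
  · simp
  · intro a _
    exact ENNReal.mul_ne_top (p.apply_ne_top a) ((f a).apply_ne_top b)

/-- The expected criticality of `S` is proportional to the probability that a random RR set is
covered by `S`. -/
theorem expectedCriticality_eq (G : SocialNetwork V) (cr : V → ℝ≥0) (hcr : 0 < ∑ v, cr v)
    (S : Finset V) :
    G.expectedCriticality cr S = (∑ v, cr v : ℝ≥0) * G.coverProb cr hcr S := by
  classical
  have h1 : G.coverProb cr hcr S =
      ∑ A, (G.rrSet cr hcr A).toReal * if (A ∩ S).Nonempty then 1 else 0 := by
    rw [coverProb, measureReal_def, PMF.toMeasure_apply_fintype, ENNReal.toReal_sum]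
    · refine Finset.sum_congr rfl fun A _ => ?_
      by_cases h : (A ∩ S).Nonempty <;> simp [h]
    · intro A _
      by_cases h : (A ∩ S).Nonempty <;> simp [h, PMF.apply_ne_top]
  have h2 : ∀ v, (origin cr hcr v).toReal = (cr v : ℝ) / (∑ v, cr v : ℝ≥0) := by
    intro v
    simp [origin]
  have hpos : (0 : ℝ) < (∑ v, cr v : ℝ≥0) := by exact_mod_cast hcr
  rw [h1, rrSet]
  simp only [toReal_bind_apply, Finset.sum_mul]
  rw [Finset.sum_comm, expectedCriticality_eq_sum]
  simp only [mul_assoc, ← Finset.mul_sum, sum_map_toReal_mul, h2]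
  simp only [Finset.mul_sum]
  rw [Finset.sum_comm]
  refine Finset.sum_congr rfl fun v _ => Finset.sum_congr rfl fun L _ => ?_
  split_ifs
  · field_simp
  · simp

theorem coverProb_nonneg (G : SocialNetwork V) (cr : V → ℝ≥0) (hcr : 0 < ∑ v, cr v)
    (S : Finset V) : 0 ≤ G.coverProb cr hcr S := measureReal_nonneg

/-- Some seed set of every positive size has positive expected criticality. -/
theorem exists_coverProb_pos (G : SocialNetwork V) (cr : V → ℝ≥0) (hcr : 0 < ∑ v, cr v)
    {k : ℕ} (hk : 1 ≤ k) (hkV : k ≤ Fintype.card V) :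
    ∃ T : Finset V, T.card = k ∧ 0 < G.coverProb cr hcr T := by
  obtain ⟨v, -, hv⟩ := Finset.exists_ne_zero_of_sum_ne_zero hcr.ne'
  obtain ⟨T, hvT, -, hT⟩ := Finset.exists_subsuperset_card_eq (Finset.subset_univ {v})
    (by simpa using hk) (by simpa using hkV)
  refine ⟨T, hT, ?_⟩
  have hpos : (0 : ℝ) < (∑ v, cr v : ℝ≥0) := by exact_mod_cast hcr
  refine pos_of_mul_pos_right (a := ((∑ v, cr v : ℝ≥0) : ℝ)) ?_ hpos.le
  rw [← expectedCriticality_eq, expectedCriticality_eq_sum]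
  have hsum : ∑ L, (G.coins L).toReal = 1 := by
    rw [← ENNReal.toReal_sum fun L _ => G.coins.apply_ne_top L]
    rw [← tsum_fintype (L := .unconditional _), G.coins.tsum_coe, ENNReal.toReal_one]
  calc (0 : ℝ) < cr v := by positivity
    _ = ∑ L, (G.coins L).toReal * cr v := by rw [← Finset.sum_mul, hsum, one_mul]
    _ ≤ _ := by
      refine Finset.sum_le_sum fun L _ => mul_le_mul_of_nonneg_left ?_ ENNReal.toReal_nonneg
      have hmem : (reverseReachable L v ∩ T).Nonempty := by
        refine ⟨v, Finset.mem_inter.mpr ⟨?_, hvT (by simp)⟩⟩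
        simp [reverseReachable, Relation.ReflTransGen.refl]
      calc (cr v : ℝ) = if (reverseReachable L v ∩ T).Nonempty then (cr v : ℝ) else 0 := by
            rw [if_pos hmem]
        _ ≤ _ := Finset.single_le_sum
            (f := fun w => if (reverseReachable L w ∩ T).Nonempty then (cr w : ℝ) else 0)
            (fun w _ => by positivity) (Finset.mem_univ v)

end SocialNetwork

namespace SocialNetwork

variable {V : Type*} [DecidableEq V]

/-! ### The approximation guarantee of greedy maximum coverage -/

theorem deg_cons (A : Finset V) (R : List (Finset V)) (S : Finset V) :
    deg (A :: R) S = deg R S + if (A ∩ S).Nonempty then 1 else 0 := by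
  simp [deg, List.countP_cons]

theorem deg_mono (R : List (Finset V)) {S T : Finset V} (h : S ⊆ T) : deg R S ≤ deg R T := by
  refine List.countP_mono_left fun A _ hA => ?_
  simp only [decide_eq_true_eq] at hA ⊢
  exact hA.mono (Finset.inter_subset_inter_left h)

/-- Submodularity of coverage, summed over the nodes of `T`. -/
theorem deg_le_add_sum (R : List (Finset V)) (S T : Finset V) :
    (deg R T : ℝ) ≤ deg R S + ∑ w ∈ T, ((deg R (insert w S) : ℝ) - deg R S) := by
  induction R with
  | nil => simp [deg]
  | cons A R ih =>
    simp only [deg_cons]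
    push_cast
    have key : (if (A ∩ T).Nonempty then (1 : ℝ) else 0) ≤ (if (A ∩ S).Nonempty then 1 else 0) +
        ∑ w ∈ T, ((if (A ∩ insert w S).Nonempty then (1 : ℝ) else 0) -
          if (A ∩ S).Nonempty then 1 else 0) := by
      have hnn : ∀ w ∈ T, 0 ≤ (if (A ∩ insert w S).Nonempty then (1 : ℝ) else 0) -
          if (A ∩ S).Nonempty then 1 else 0 := by
        intro w _
        by_cases hS : (A ∩ S).Nonempty
        · have : (A ∩ insert w S).Nonempty :=
            hS.mono (Finset.inter_subset_inter_left (Finset.subset_insert w S))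
          simp [hS, this]
        · rw [if_neg hS, sub_zero]
          positivity
      by_cases hS : (A ∩ S).Nonempty
      · have := Finset.sum_nonneg hnn
        rw [if_pos hS] at this ⊢
        split_ifs <;> linarith
      · by_cases hT : (A ∩ T).Nonempty
        · obtain ⟨w, hw⟩ := hT
          have hw' := Finset.mem_inter.mp hw
          have h1 := Finset.single_le_sum hnn hw'.2
          have h2 : (A ∩ insert w S).Nonempty := ⟨w, by simp [hw'.1]⟩
          rw [if_pos h2] at h1
          rw [if_pos ⟨w, hw⟩]
          linarith
        · have := Finset.sum_nonneg hnn
          rw [if_neg hS] at this ⊢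
          rw [if_neg hT]
          linarith
    have hsplit : ∑ w ∈ T, ((deg R (insert w S) + if (A ∩ insert w S).Nonempty then (1 : ℝ) else 0) -
        (deg R S + if (A ∩ S).Nonempty then (1 : ℝ) else 0)) =
        ∑ w ∈ T, ((deg R (insert w S) : ℝ) - deg R S) +
        ∑ w ∈ T, ((if (A ∩ insert w S).Nonempty then (1 : ℝ) else 0) -
          if (A ∩ S).Nonempty then 1 else 0) := by
      rw [← Finset.sum_add_distrib]
      exact Finset.sum_congr rfl fun w _ => by ring
    rw [hsplit]
    linarith

theorem IsGreedy.card_eq {R : List (Finset V)} {k : ℕ} {S : Finset V} (h : IsGreedy R k S) :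
    S.card = k := by
  induction h with
  | zero => rfl
  | succ _ hv _ ih => rw [Finset.card_insert_of_notMem hv, ih]

/-- By submodularity some node of `T` gains at least a `1 / |T|` share of the remaining gap, so each
greedy step shrinks the gap by the factor `1 - 1 / |T|`. -/
theorem IsGreedy.sub_deg_le {R : List (Finset V)} {j : ℕ} {S : Finset V} (h : IsGreedy R j S)
    {T : Finset V} (hT : 1 ≤ T.card) :
    (deg R T : ℝ) - deg R S ≤ (1 - 1 / (T.card : ℝ)) ^ j * deg R T := by
  have hk : (1 : ℝ) ≤ T.card := by exact_mod_cast hT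
  induction h with
  | zero => simp
  | @succ j S v hS hv hmax ih =>
    have hle : ∀ w, (deg R (insert w S) : ℝ) ≤ deg R (insert v S) := by
      intro w
      by_cases hw : w ∈ S
      · rw [Finset.insert_eq_of_mem hw]
        exact_mod_cast deg_mono R (Finset.subset_insert v S)
      · exact_mod_cast hmax w hw
    have h1 : (deg R T : ℝ) ≤
        deg R S + T.card * ((deg R (insert v S) : ℝ) - deg R S) := by
      refine (deg_le_add_sum R S T).trans ?_
      have := Finset.sum_le_card_nsmul T (fun w => (deg R (insert w S) : ℝ) - deg R S)
        ((deg R (insert v S) : ℝ) - deg R S) fun w _ => by linarith [hle w]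
      rw [nsmul_eq_mul] at this
      linarith
    have hk0 : (0 : ℝ) < T.card := by linarith
    have h2 : ((deg R T : ℝ) - deg R S) / T.card ≤ (deg R (insert v S) : ℝ) - deg R S := by
      rw [div_le_iff₀ hk0]
      linarith
    have h3 : 0 ≤ 1 - 1 / (T.card : ℝ) := by
      rw [sub_nonneg, div_le_one hk0]
      exact hk
    calc (deg R T : ℝ) - deg R (insert v S)
        ≤ (1 - 1 / (T.card : ℝ)) * ((deg R T : ℝ) - deg R S) := by
          rw [sub_mul, one_mul, one_div_mul_eq_div]
          linarith
      _ ≤ (1 - 1 / (T.card : ℝ)) * ((1 - 1 / (T.card : ℝ)) ^ j * deg R T) :=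
          mul_le_mul_of_nonneg_left ih h3
      _ = _ := by ring

/-- Greedy maximum coverage is a `1 - 1/e` approximation. -/
theorem IsGreedy.mul_deg_le {R : List (Finset V)} {k : ℕ} {S T : Finset V} (h : IsGreedy R k S)
    (hk : 1 ≤ k) (hT : T.card = k) :
    (1 - 1 / Real.exp 1) * (deg R T : ℝ) ≤ deg R S := by
  have h1 := h.sub_deg_le (T := T) (by omega)
  have hk0 : (1 : ℝ) ≤ k := by exact_mod_cast hk
  have h2 : (1 - 1 / (T.card : ℝ)) ^ k ≤ 1 / Real.exp 1 := by
    rw [hT]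
    have h3 : (1 - 1 / (k : ℝ)) ≤ Real.exp (-(1 / (k : ℝ))) := by
      linarith [Real.add_one_le_exp (-(1 / (k : ℝ)))]
    calc (1 - 1 / (k : ℝ)) ^ k ≤ Real.exp (-(1 / (k : ℝ))) ^ k :=
          pow_le_pow_left₀ (by rw [sub_nonneg, div_le_one (by linarith)]; exact hk0) h3 k
      _ = 1 / Real.exp 1 := by
          rw [← Real.exp_nat_mul, one_div (Real.exp 1), ← Real.exp_neg]
          congr 1
          field_simp
  have := mul_le_mul_of_nonneg_right h2 (Nat.cast_nonneg (α := ℝ) (deg R T))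
  linarith

end SocialNetwork

namespace SocialNetwork

/-! ### Concentration of the coverage of a fixed set -/

section

variable {V : Type*} [DecidableEq V]

theorem deg_map_range (R : ℕ → Finset V) (n : ℕ) (S : Finset V) :
    (deg ((List.range n).map R) S : ℝ) =
      ∑ i ∈ Finset.range n, if (R i ∩ S).Nonempty then 1 else 0 := by
  induction n with
  | zero => simp [deg]
  | succ n ih =>
    rw [Finset.sum_range_succ, ← ih, List.range_succ, List.map_append]
    simp [deg, List.countP_append, List.countP_cons]

theorem deg_map_range_le (R : ℕ → Finset V) (n : ℕ) (S : Finset V) :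
    deg ((List.range n).map R) S ≤ n := by
  simpa [deg] using List.countP_le_length (p := fun A : Finset V => decide (A ∩ S).Nonempty)
    (l := (List.range n).map R)

theorem measurable_deg_map_range (n : ℕ) (S : Finset V) :
    Measurable fun R : ℕ → Finset V => (deg ((List.range n).map R) S : ℝ) := by
  simp only [deg_map_range]
  refine Finset.measurable_sum _ fun i _ => ?_
  exact (measurable_from_top (f := fun A : Finset V => if (A ∩ S).Nonempty then (1 : ℝ) else 0)).comp
    (measurable_pi_apply i)

end

variable {V : Type*} [Fintype V] [DecidableEq V]

instance isProbabilityMeasure_rrSequence (G : SocialNetwork V) (cr : V → ℝ≥0)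
    (hcr : 0 < ∑ v, cr v) : IsProbabilityMeasure (G.rrSequence cr hcr) := by
  unfold rrSequence
  infer_instance

theorem integrable_exp_mul_deg (G : SocialNetwork V) (cr : V → ℝ≥0) (hcr : 0 < ∑ v, cr v)
    (n : ℕ) (S : Finset V) (s : ℝ) :
    Integrable (fun R => Real.exp (s * (deg ((List.range n).map R) S : ℝ)))
      (G.rrSequence cr hcr) := by
  refine Integrable.of_bound (C := Real.exp (|s| * n))
    (Real.measurable_exp.comp ((measurable_deg_map_range n S).const_mul s)).aestronglyMeasurable
    (Filter.Eventually.of_forall fun R => ?_)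
  rw [Real.norm_eq_abs, Real.abs_exp, Real.exp_le_exp]
  have h : (deg ((List.range n).map R) S : ℝ) ≤ n := by exact_mod_cast deg_map_range_le R n S
  exact mul_le_mul (le_abs_self s) h (Nat.cast_nonneg _) (abs_nonneg s)

/-- By independence this is a product of Bernoulli factors `1 + p (exp s - 1)`, each at most `exp (p
(exp s - 1))`. -/
theorem mgf_deg_le (G : SocialNetwork V) (cr : V → ℝ≥0) (hcr : 0 < ∑ v, cr v)
    (n : ℕ) (S : Finset V) (s : ℝ) :
    ProbabilityTheory.mgf (fun R => (deg ((List.range n).map R) S : ℝ)) (G.rrSequence cr hcr) s ≤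
      Real.exp (n * G.coverProb cr hcr S * (Real.exp s - 1)) := by
  set f : Finset V → ℝ := fun A => if (A ∩ S).Nonempty then 1 else 0 with hf
  have hfm : Measurable f := measurable_from_top
  have hsum : (fun R : ℕ → Finset V => (deg ((List.range n).map R) S : ℝ)) =
      ∑ i ∈ Finset.range n, fun R : ℕ → Finset V => f (R i) := by
    funext R
    rw [deg_map_range, Finset.sum_apply]
  have hind : ProbabilityTheory.iIndepFun (fun (i : ℕ) (R : ℕ → Finset V) => f (R i))
      (G.rrSequence cr hcr) :=
    ProbabilityTheory.iIndepFun_infinitePi fun _ => hfm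
  rw [hsum, hind.mgf_sum fun i => hfm.comp (measurable_pi_apply i)]
  have hone : ∀ i : ℕ,
      ProbabilityTheory.mgf (fun R : ℕ → Finset V => f (R i)) (G.rrSequence cr hcr) s ≤
        Real.exp (G.coverProb cr hcr S * (Real.exp s - 1)) := by
    intro i
    have h1 : ProbabilityTheory.mgf (fun R : ℕ → Finset V => f (R i)) (G.rrSequence cr hcr) s =
        ∫ A, Real.exp (s * f A) ∂(G.rrSet cr hcr).toMeasure := by
      have hmp := measurePreserving_eval_infinitePi
        (fun _ : ℕ => (G.rrSet cr hcr).toMeasure) i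
      rw [← hmp.map_eq, integral_map hmp.measurable.aemeasurable
        (Measurable.aestronglyMeasurable measurable_from_top)]
      rfl
    have h2 : (fun A => Real.exp (s * f A)) = fun A =>
        1 + ({A : Finset V | (A ∩ S).Nonempty}).indicator (fun _ => Real.exp s - 1) A := by
      funext A
      by_cases h : (A ∩ S).Nonempty <;> simp [hf, h]
    have h3 : MeasurableSet {A : Finset V | (A ∩ S).Nonempty} := trivial
    rw [h1, h2, integral_add (integrable_const _) ((integrable_const _).indicator h3),
      integral_indicator_const _ h3]
    simp only [integral_const, probReal_univ, smul_eq_mul, one_mul]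
    have := Real.add_one_le_exp (G.coverProb cr hcr S * (Real.exp s - 1))
    unfold coverProb at this ⊢
    linarith
  calc _ ≤ ∏ _i ∈ Finset.range n, Real.exp (G.coverProb cr hcr S * (Real.exp s - 1)) :=
        Finset.prod_le_prod (fun i _ => ProbabilityTheory.mgf_nonneg) fun i _ => hone i
    _ = _ := by
        rw [Finset.prod_const, Finset.card_range, ← Real.exp_nat_mul, mul_assoc]

/-- Chernoff's upper tail bound. -/
theorem measure_le_deg_le (G : SocialNetwork V) (cr : V → ℝ≥0) (hcr : 0 < ∑ v, cr v)
    (n : ℕ) (S : Finset V) {m t : ℝ} (hm : n * G.coverProb cr hcr S ≤ m) (hm0 : 0 < m)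
    (hmt : m ≤ t) :
    (G.rrSequence cr hcr).real {R | t ≤ deg ((List.range n).map R) S} ≤
      Real.exp (-(t * (m / t - 1 - Real.log (m / t)))) := by
  have ht : 0 < t := hm0.trans_le hmt
  -- `log (t / m)` is the exponent minimizing `exp (-s t + m (exp s - 1))`.
  have hs : 0 ≤ Real.log (t / m) := Real.log_nonneg ((one_le_div hm0).mpr hmt)
  refine (ProbabilityTheory.measure_ge_le_exp_mul_mgf t hs
    (integrable_exp_mul_deg G cr hcr n S _)).trans ?_
  refine (mul_le_mul_of_nonneg_left (mgf_deg_le G cr hcr n S _) (Real.exp_pos _).le).trans ?_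
  rw [← Real.exp_add, Real.exp_le_exp, Real.exp_log (by positivity)]
  have h1 : n * G.coverProb cr hcr S * (t / m - 1) ≤ m * (t / m - 1) :=
    mul_le_mul_of_nonneg_right hm (by rw [sub_nonneg, one_le_div hm0]; exact hmt)
  have h2 : m * (t / m - 1) = t - m := by field_simp
  have h3 : t * (m / t - 1 - Real.log (m / t)) = m - t + t * Real.log (t / m) := by
    rw [← inv_div t m, Real.log_inv]
    field_simp
    ring
  rw [h3]
  linarith

theorem exp_neg_le_quadratic {s : ℝ} (hs : 0 ≤ s) : Real.exp (-s) ≤ 1 - s + s ^ 2 / 2 := by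
  have hmono : AntitoneOn (fun x : ℝ => Real.exp (-x) - (1 - x + x ^ 2 / 2)) (Set.Ici 0) := by
    refine antitoneOn_of_deriv_nonpos (convex_Ici 0) (by fun_prop) (by fun_prop) fun x _ => ?_
    have hd : HasDerivAt (fun x : ℝ => Real.exp (-x) - (1 - x + x ^ 2 / 2))
        (Real.exp (-x) * (-1) - (-1 + x)) x := by
      have h1 := (hasDerivAt_id x).neg.exp
      have h2 := (((hasDerivAt_id x).const_sub 1).add (((hasDerivAt_id x).pow 2).div_const 2))
      exact (h1.sub h2).congr_deriv (by simp)
    rw [hd.deriv]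
    linarith [Real.add_one_le_exp (-x)]
  have := hmono (Set.mem_Ici.mpr le_rfl) (Set.mem_Ici.mpr hs) hs
  simp only [neg_zero, Real.exp_zero] at this
  norm_num at this
  linarith

/-- The difference of the two sides vanishes at 1 and is monotone because `x + 1/x ≥ 2`. It turns
the entropy form of the upper tail into a quadratic exponent. -/
theorem sq_half_le_sub_one_sub_log {y : ℝ} (hy : 0 < y) (hy1 : y ≤ 1) :
    (1 - y) ^ 2 / 2 ≤ y - 1 - Real.log y := by
  have hmono : AntitoneOn (fun x : ℝ => x - 1 - Real.log x - (1 - x) ^ 2 / 2) (Set.Ioc 0 1) := by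
    have hd : ∀ x : ℝ, 0 < x → HasDerivAt
        (fun x : ℝ => x - 1 - Real.log x - (1 - x) ^ 2 / 2) (1 - x⁻¹ + (1 - x)) x := by
      intro x hx
      have h1 := ((hasDerivAt_id x).sub_const 1).sub (Real.hasDerivAt_log hx.ne')
      have h2 := (((hasDerivAt_id x).const_sub 1).pow 2).div_const 2
      exact (h1.sub h2).congr_deriv (by simp; ring)
    refine antitoneOn_of_deriv_nonpos (convex_Ioc 0 1)
      (fun x hx => (hd x hx.1).continuousAt.continuousWithinAt)
      (fun x hx => ?_) fun x hx => ?_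
    · rw [interior_Ioc] at hx
      exact (hd x hx.1).differentiableAt.differentiableWithinAt
    · rw [interior_Ioc] at hx
      rw [(hd x hx.1).deriv]
      have : x + x⁻¹ ≥ 2 := by
        have hx0 := hx.1
        have : x + x⁻¹ - 2 = (x - 1) ^ 2 / x := by
          field_simp
          ring
        have : 0 ≤ (x - 1) ^ 2 / x := by positivity
        linarith
      linarith
  have := hmono ⟨hy, hy1⟩ (Set.right_mem_Ioc.mpr one_pos) hy1
  simp at this
  linarith

/-- Chernoff's lower tail bound. -/
theorem measure_deg_le_le (G : SocialNetwork V) (cr : V → ℝ≥0) (hcr : 0 < ∑ v, cr v)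
    (n : ℕ) (S : Finset V) {s : ℝ} (hs : 0 ≤ s) :
    (G.rrSequence cr hcr).real
        {R | (deg ((List.range n).map R) S : ℝ) ≤ (1 - s) * (n * G.coverProb cr hcr S)} ≤
      Real.exp (-(s ^ 2 * (n * G.coverProb cr hcr S) / 2)) := by
  refine (ProbabilityTheory.measure_le_le_exp_mul_mgf _ (neg_nonpos.mpr hs)
    (integrable_exp_mul_deg G cr hcr n S _)).trans ?_
  refine (mul_le_mul_of_nonneg_left (mgf_deg_le G cr hcr n S _) (Real.exp_pos _).le).trans ?_
  rw [← Real.exp_add, Real.exp_le_exp]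
  have hp : 0 ≤ n * G.coverProb cr hcr S :=
    mul_nonneg (Nat.cast_nonneg _) (coverProb_nonneg G cr hcr S)
  have := mul_le_mul_of_nonneg_left (exp_neg_le_quadratic hs) hp
  nlinarith

end SocialNetwork

namespace SocialNetwork

/-! ### Summing the failure probabilities of the check points -/

/-- A bound for the probability that Targeted-IM fails at a check point, in terms of the ratio `x`
of the expected coverage of the optimal seed set and `2 φ ^ 2`. -/
noncomputable def stageBound (L x : ℝ) : ℝ :=
  if x < 1 then Real.exp (-L) ^ 4 * x else 2 * Real.exp (-(L * x))

theorem stageBound_nonneg (L : ℝ) {x : ℝ} (hx : 0 ≤ x) : 0 ≤ stageBound L x := by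
  unfold stageBound
  split_ifs <;> positivity

/-- A potential that decreases by at least `stageBound L x` when `x` is doubled. -/
noncomputable def stagePotential (L x : ℝ) : ℝ :=
  if x < 1 then 3 * Real.exp (-L) - Real.exp (-L) * x / 8
  else 2 * (Real.exp (-(L * x)) + 9 / 8 * Real.exp (-(L * x)) ^ 2)

/-- For `x ≥ 1`, doubling squares `y = exp (-(L x)) ≤ 1/3`, and `y² + y⁴ + y⁸ + ⋯ ≤ y² / (1 - 1/9)`
explains the `9/8`. For `x < 1` the cost is at most `r x / 27`, paid by the drop `r x / 8`. At the
crossing the new potential is at most `(2 + 3/4) r`, leaving room below `3 r`. -/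
theorem stageBound_add_stagePotential_le {L x : ℝ} (hL : Real.exp (-L) ≤ 1 / 3) (hx : 0 < x) :
    stageBound L x + stagePotential L (2 * x) ≤ stagePotential L x := by
  have hr0 := Real.exp_pos (-L)
  have hL0 : 0 ≤ L := by
    by_contra h
    have := Real.one_le_exp (x := -L) (by linarith)
    linarith
  have hle : ∀ y, 1 ≤ y → Real.exp (-(L * y)) ≤ Real.exp (-L) := by
    intro y hy
    rw [Real.exp_le_exp]
    nlinarith
  unfold stageBound stagePotential
  set r := Real.exp (-L)
  have hr4 : r ^ 4 ≤ r / 27 := by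
    have : r ^ 3 ≤ (1 / 3) ^ 3 := pow_le_pow_left₀ hr0.le hL 3
    calc r ^ 4 = r * r ^ 3 := by ring
      _ ≤ r * (1 / 3) ^ 3 := by gcongr
      _ = r / 27 := by ring
  by_cases h1 : x < 1
  · have h4 : r ^ 4 * x ≤ r / 27 * x := by gcongr
    have hrx : 0 < r * x := by positivity
    by_cases h2 : 2 * x < 1
    · rw [if_pos h1, if_pos h2, if_pos h1]
      nlinarith
    · rw [if_pos h1, if_neg h2, if_pos h1]
      have hy := hle (2 * x) (by linarith)
      set y := Real.exp (-(L * (2 * x)))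
      have hy0 : 0 < y := Real.exp_pos _
      have : y ^ 2 ≤ r * (1 / 3) := by
        rw [sq]
        exact mul_le_mul hy (hy.trans hL) hy0.le hr0.le
      have : r * x ≤ r := by nlinarith
      linarith
  · rw [if_neg h1, if_neg (by linarith), if_neg h1]
    have hy := (hle x (by linarith)).trans hL
    have h2 : Real.exp (-(L * (2 * x))) = Real.exp (-(L * x)) ^ 2 := by
      rw [← Real.exp_nat_mul]
      congr 1
      push_cast
      ring
    rw [h2]
    set y := Real.exp (-(L * x))
    have hy0 : 0 < y := Real.exp_pos _
    have : y ^ 2 ≤ 1 / 9 := by nlinarith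
    nlinarith [sq_nonneg y]

theorem stagePotential_nonneg (L x : ℝ) : 0 ≤ stagePotential L x := by
  have hr0 := Real.exp_pos (-L)
  unfold stagePotential
  split_ifs with h
  · nlinarith
  · positivity

theorem stagePotential_le {L x : ℝ} (hL : Real.exp (-L) ≤ 1 / 3) (hx : 0 < x) :
    stagePotential L x ≤ 3 * Real.exp (-L) := by
  have hr0 := Real.exp_pos (-L)
  unfold stagePotential
  split_ifs with h
  · have : 0 < Real.exp (-L) * x := by positivity
    linarith
  · have hL0 : 0 ≤ L := by
      by_contra h
      have := Real.one_le_exp (x := -L) (by linarith)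
      linarith
    have hy : Real.exp (-(L * x)) ≤ Real.exp (-L) := by
      rw [Real.exp_le_exp]
      nlinarith
    set y := Real.exp (-(L * x))
    have hy0 : 0 < y := Real.exp_pos _
    have : y ^ 2 ≤ Real.exp (-L) * (1 / 3) := by
      rw [sq]
      exact mul_le_mul hy (hy.trans hL) hy0.le hr0.le
    linarith

theorem sum_stageBound_le {L x : ℝ} (hL : Real.exp (-L) ≤ 1 / 3) (hx : 0 < x) (M : ℕ) :
    ∑ j ∈ Finset.range M, stageBound L (2 ^ j * x) ≤ 3 * Real.exp (-L) := by
  have h : ∑ j ∈ Finset.range M, stageBound L (2 ^ j * x) + stagePotential L (2 ^ M * x) ≤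
      stagePotential L x := by
    induction M with
    | zero => simp
    | succ M ih =>
      rw [Finset.sum_range_succ]
      have := stageBound_add_stagePotential_le (x := 2 ^ M * x) hL (by positivity)
      rw [show 2 ^ (M + 1) * x = 2 * (2 ^ M * x) by ring]
      linarith
  have h1 := stagePotential_le hL hx
  have h2 := stagePotential_nonneg L (2 ^ M * x)
  linarith

/-! ### The failure probability of a single check point -/

variable {V : Type*} [Fintype V] [DecidableEq V]

/-- Union bound over the seed sets of size `k` with a small cover probability. -/
theorem measure_exists_le_deg_le (G : SocialNetwork V) (cr : V → ℝ≥0) (hcr : 0 < ∑ v, cr v)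
    (k n : ℕ) {m t : ℝ} (hm0 : 0 < m) (hmt : m ≤ t) :
    (G.rrSequence cr hcr).real {R | ∃ S : Finset V, S.card = k ∧
        n * G.coverProb cr hcr S ≤ m ∧ t ≤ deg ((List.range n).map R) S} ≤
      (Fintype.card V).choose k * Real.exp (-(t * (m / t - 1 - Real.log (m / t)))) := by
  have hsub : {R : ℕ → Finset V | ∃ S : Finset V, S.card = k ∧
      n * G.coverProb cr hcr S ≤ m ∧ t ≤ deg ((List.range n).map R) S} ⊆
      ⋃ S ∈ (Finset.univ : Finset V).powersetCard k,
        {R | n * G.coverProb cr hcr S ≤ m ∧ t ≤ deg ((List.range n).map R) S} := by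
    rintro R ⟨S, hS, h⟩
    simp only [Set.mem_iUnion, Finset.mem_powersetCard]
    exact ⟨S, ⟨Finset.subset_univ _, hS⟩, h⟩
  refine (measureReal_mono hsub (measure_ne_top _ _)).trans ((measureReal_biUnion_finset_le _ _).trans ?_)
  rw [← Finset.card_univ, ← Finset.card_powersetCard, ← nsmul_eq_mul]
  refine Finset.sum_le_card_nsmul _ _ _ fun S _ => ?_
  by_cases h : n * G.coverProb cr hcr S ≤ m
  · simp only [h, true_and]
    exact measure_le_deg_le G cr hcr n S h hm0 hmt
  · simp only [h, false_and, Set.ofPred_false, measureReal_empty]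
    positivity

/-- `R` is misleading at sample size `n` if some bad seed set `S` could be returned there. -/
def Misleading (G : SocialNetwork V) (cr : V → ℝ≥0) (hcr : 0 < ∑ v, cr v) (k : ℕ) (a ε γ : ℝ)
    (T : Finset V) (n : ℕ) (R : ℕ → Finset V) : Prop :=
  ∃ S : Finset V, S.card = k ∧ G.coverProb cr hcr S < (a - ε) * G.coverProb cr hcr T ∧
    γ ≤ deg ((List.range n).map R) S ∧
    a * deg ((List.range n).map R) T ≤ deg ((List.range n).map R) S

/-- At small check points, bad seed sets are unlikely to reach the threshold. -/
theorem measure_misleading_le_of_lt_one (G : SocialNetwork V) (cr : V → ℝ≥0)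
    (hcr : 0 < ∑ v, cr v) {k : ℕ} (hkV : k ≤ Fintype.card V) {a ε γ g L : ℝ} (T : Finset V) {n : ℕ}
    (hn : 0 < n) (hq : 0 < G.coverProb cr hcr T) (hc0 : 0 < a - ε) (hc1 : a - ε < 1) (hg : 0 < g)
    (hγ : g ≤ γ) (hL : 1 ≤ L)
    (hgc : 4 * L + Real.log ((Fintype.card V).choose k) ≤ g * ((1 - (a - ε)) ^ 2 / 2))
    (hx : n * G.coverProb cr hcr T / g < 1) :
    (G.rrSequence cr hcr).real {R | Misleading G cr hcr k a ε γ T n R} ≤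
      Real.exp (-L) ^ 4 * (n * G.coverProb cr hcr T / g) := by
  have hn' : (0 : ℝ) < n := by exact_mod_cast hn
  set q := G.coverProb cr hcr T
  set c := a - ε with hc
  set x := n * q / g with hxdef
  have hx0 : 0 < x := by positivity
  have hnq : n * q = x * g := by rw [hxdef]; field_simp
  have hm0 : 0 < c * x * g := by positivity
  have hcx : c * x ≤ 1 := by nlinarith
  have hmt : c * x * g ≤ g := by nlinarith
  have hC : (0 : ℝ) < (Fintype.card V).choose k := by exact_mod_cast Nat.choose_pos hkV
  have hC1 : (0 : ℝ) ≤ Real.log ((Fintype.card V).choose k) :=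
    Real.log_nonneg (by exact_mod_cast Nat.choose_pos hkV)
  refine (measureReal_mono ?_).trans
    ((measure_exists_le_deg_le G cr hcr k n hm0 hmt).trans ?_)
  · rintro R ⟨S, hS, hp, hd, -⟩
    refine ⟨S, hS, ?_, hγ.trans hd⟩
    calc n * G.coverProb cr hcr S ≤ n * (c * q) := by gcongr
      _ = c * (n * q) := by ring
      _ = c * x * g := by rw [hnq]; ring
  · rw [mul_div_assoc, div_self hg.ne', mul_one, Real.log_mul hc0.ne' hx0.ne']
    calc _ = Real.exp (Real.log ((Fintype.card V).choose k) +
          -(g * (c * x - 1 - (Real.log c + Real.log x)))) := by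
          rw [Real.exp_add, Real.exp_log hC]
      _ ≤ Real.exp (4 * -L + Real.log x) := by
          rw [Real.exp_le_exp]
          have hlx : Real.log x ≤ 0 := Real.log_nonpos hx0.le hx.le
          have h1 := Real.log_le_sub_one_of_pos hx0
          have h2 := sq_half_le_sub_one_sub_log hc0 hc1.le
          have h3 : g * ((1 - c) ^ 2 / 2) ≤ g * (c - 1 - Real.log c) := by gcongr
          -- This extracts a full factor `x` from the tail, which makes the bounds summable over
          -- arbitrarily many small check points.
          have h4 : 1 ≤ g * (1 - c) := by
            have : g * (1 - c) ^ 2 ≤ g * (1 - c) := by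
              gcongr
              nlinarith
            linarith
          have h5 : c * x - 1 - (Real.log c + Real.log x) ≥
              (c - 1 - Real.log c) - (1 - c) * Real.log x := by nlinarith
          have h6 := mul_le_mul_of_nonneg_left h5 hg.le
          have h7 : g * (1 - c) * Real.log x ≤ 1 * Real.log x :=
            mul_le_mul_of_nonpos_right h4 hlx
          linarith
      _ = Real.exp (-L) ^ 4 * x := by
          rw [Real.exp_add, Real.exp_log hx0, ← Real.exp_nat_mul]
          norm_num

/-- At large check points, coverage is a good estimate of the cover probability. -/
theorem measure_misleading_le_of_one_le (G : SocialNetwork V) (cr : V → ℝ≥0)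
    (hcr : 0 < ∑ v, cr v) {k : ℕ} (hkV : k ≤ Fintype.card V) {a ε γ φ L σ τ : ℝ} (T : Finset V)
    {n : ℕ} (hn : 0 < n) (hq : 0 < G.coverProb cr hcr T) (hc0 : 0 < a - ε) (hε : 0 < ε)
    (hσ0 : 0 < σ) (hτ0 : 0 < τ) (hσ : σ ^ 2 = L)
    (hτ : τ ^ 2 = a * (Real.log ((Fintype.card V).choose k) + L)) (hφ : φ = (a * σ + τ) / ε)
    (hx : 1 ≤ n * G.coverProb cr hcr T / (2 * φ ^ 2)) :
    (G.rrSequence cr hcr).real {R | Misleading G cr hcr k a ε γ T n R} ≤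
      2 * Real.exp (-(L * (n * G.coverProb cr hcr T / (2 * φ ^ 2)))) := by
  have hn' : (0 : ℝ) < n := by exact_mod_cast hn
  have ha : 0 < a := by linarith
  have hφ0 : 0 < φ := by rw [hφ]; positivity
  set q := G.coverProb cr hcr T with hqdef
  set c := a - ε with hc
  set x := n * q / (2 * φ ^ 2) with hxdef
  have hx0 : 0 < x := by positivity
  have hnq : n * q = x * (2 * φ ^ 2) := by rw [hxdef]; field_simp
  have hnq0 : 0 < n * q := by positivity
  have hC : (0 : ℝ) < (Fintype.card V).choose k := by exact_mod_cast Nat.choose_pos hkV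
  have hC1 : (0 : ℝ) ≤ Real.log ((Fintype.card V).choose k) :=
    Real.log_nonneg (by exact_mod_cast Nat.choose_pos hkV)
  -- This is what the choice of `φ` achieves: relative error `σ / φ` for `T`, and a margin `τ / φ`
  -- between `b` and `c` for bad sets.
  have hsplit : a * (σ / φ) + τ / φ = ε := by
    rw [hφ]
    field_simp
  set b := a * (1 - σ / φ) with hb
  have hbc : b = c + τ / φ := by rw [hb, hc, ← hsplit]; ring
  have hτφ : 0 < τ / φ := by positivity
  have hσφ : 0 < σ / φ := by positivity
  have hb0 : 0 < b := by linarith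
  have hba : b ≤ a := by rw [hb]; nlinarith
  have hsub : {R | Misleading G cr hcr k a ε γ T n R} ⊆
      {R | (deg ((List.range n).map R) T : ℝ) ≤ (1 - σ / φ) * (n * q)} ∪
      {R | ∃ S : Finset V, S.card = k ∧ n * G.coverProb cr hcr S ≤ c * (n * q) ∧
        b * (n * q) ≤ deg ((List.range n).map R) S} := by
    rintro R ⟨S, hS, hp, -, hd⟩
    by_cases h : (deg ((List.range n).map R) T : ℝ) ≤ (1 - σ / φ) * (n * q)
    · exact Or.inl h
    · refine Or.inr ⟨S, hS, ?_, ?_⟩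
      · calc n * G.coverProb cr hcr S ≤ n * (c * q) := by gcongr
          _ = c * (n * q) := by ring
      · refine le_trans ?_ hd
        rw [hb, mul_assoc]
        exact mul_le_mul_of_nonneg_left (not_le.mp h).le ha.le
  have hlow := measure_deg_le_le G cr hcr n T hσφ.le
  have hhigh := measure_exists_le_deg_le G cr hcr k n (m := c * (n * q)) (t := b * (n * q))
    (by positivity) (by gcongr; linarith)
  have hlow' : Real.exp (-((σ / φ) ^ 2 * (n * q) / 2)) = Real.exp (-(L * x)) := by
    congr 2
    rw [hnq, div_pow, hσ]
    field_simp
  have hhigh' : (Fintype.card V).choose k * Real.exp (-(b * (n * q) *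
      (c * (n * q) / (b * (n * q)) - 1 - Real.log (c * (n * q) / (b * (n * q)))))) ≤
      Real.exp (-(L * x)) := by
    rw [mul_div_mul_right _ _ hnq0.ne']
    have h1 := sq_half_le_sub_one_sub_log (y := c / b) (by positivity)
      (by rw [div_le_one hb0]; linarith)
    have h2 := mul_le_mul_of_nonneg_left h1 (mul_pos hb0 hnq0).le
    have h3 : b * (n * q) * ((1 - c / b) ^ 2 / 2) = x * τ ^ 2 / b := by
      have : 1 - c / b = τ / φ / b := by
        rw [eq_div_iff hb0.ne', sub_mul, div_mul_cancel₀ _ hb0.ne']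
        linarith
      rw [this, hnq]
      field_simp
    have h4 : x * (Real.log ((Fintype.card V).choose k) + L) ≤ x * τ ^ 2 / b := by
      rw [le_div_iff₀ hb0, hτ]
      have : 0 ≤ Real.log ((Fintype.card V).choose k) + L := by
        rw [← hσ]; positivity
      nlinarith [mul_nonneg hx0.le this]
    calc _ ≤ (Fintype.card V).choose k *
          Real.exp (-(x * (Real.log ((Fintype.card V).choose k) + L))) := by
          refine mul_le_mul_of_nonneg_left (Real.exp_le_exp.mpr ?_) hC.le
          linarith
      _ = Real.exp (Real.log ((Fintype.card V).choose k) +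
          -(x * (Real.log ((Fintype.card V).choose k) + L))) := by
          rw [Real.exp_add, Real.exp_log hC]
      _ ≤ Real.exp (-(L * x)) := by
          rw [Real.exp_le_exp]
          nlinarith
  have := (measureReal_mono (μ := G.rrSequence cr hcr) hsub).trans (measureReal_union_le _ _)
  linarith

/-- The sample sizes at which bad seed sets may get past the threshold are negligible. -/
theorem le_mul_sq_of_eq_div {a ε φ L B σ τ : ℝ} (hε : 0 < ε) (hεa : ε < a) (ha : a < 1)
    (hσ0 : 0 < σ) (hτ0 : 0 < τ) (hσ : σ ^ 2 = L) (hLB : L ≤ B) (hτ : τ ^ 2 = a * B)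
    (hφ : φ = (a * σ + τ) / ε) :
    3 * L + B ≤ 2 * φ ^ 2 * ((1 - (a - ε)) ^ 2 / 2) := by
  have ha0 : 0 < a := hε.trans hεa
  have hL0 : 0 < L := by rw [← hσ]; positivity
  -- Equivalent to `(1 - a) (a - ε) ≥ 0`. Squaring, with `τ / a ≥ σ`, gives `L + 2 L + B`.
  have h1 : σ + τ / a ≤ φ * (1 - (a - ε)) := by
    have h2 : 1 / a ≤ (1 - (a - ε)) / ε := by
      rw [div_le_div_iff₀ ha0 hε]
      nlinarith
    calc σ + τ / a = (a * σ + τ) * (1 / a) := by field_simp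
      _ ≤ (a * σ + τ) * ((1 - (a - ε)) / ε) := by gcongr
      _ = _ := by rw [hφ]; ring
  have h3 : σ ≤ τ / a := by
    rw [le_div_iff₀ ha0]
    refine le_of_sq_le_sq ?_ hτ0.le
    rw [mul_pow, hσ, hτ]
    nlinarith [mul_le_mul_of_nonneg_left hLB ha0.le, mul_pos hL0 ha0]
  have h4 : B ≤ (τ / a) ^ 2 := by
    rw [div_pow, hτ, le_div_iff₀ (by positivity)]
    nlinarith [mul_pos ha0 (hL0.trans_le hLB)]
  have h5 : (σ + τ / a) ^ 2 ≤ (φ * (1 - (a - ε))) ^ 2 := by gcongr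
  nlinarith

end SocialNetwork

namespace SocialNetwork

variable {V : Type*} [Fintype V] [DecidableEq V]

/-! ### Termination and the failure probability of Targeted-IM -/

/-- The set returned at some check point eventually passes the threshold, almost surely. -/
theorem measure_forall_deg_lt_eq_zero (G : SocialNetwork V) (cr : V → ℝ≥0) (hcr : 0 < ∑ v, cr v)
    {a γ : ℝ} (T : Finset V) (ha : 0 < a) (hγ : 0 < γ) (hq : 0 < G.coverProb cr hcr T) :
    (G.rrSequence cr hcr).real {R | ∀ j, a * deg (samples γ R j) T < γ} = 0 := by
  refine le_antisymm ?_ measureReal_nonneg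
  set q := G.coverProb cr hcr T
  have hN : (0 : ℝ) < ⌈γ⌉₊ := by exact_mod_cast Nat.ceil_pos.mpr hγ
  have htend : Filter.Tendsto (fun j : ℕ => ((2 ^ j * ⌈γ⌉₊ : ℕ) : ℝ) * q) Filter.atTop
      Filter.atTop := by
    push_cast
    exact ((tendsto_pow_atTop_atTop_of_one_lt one_lt_two).atTop_mul_const hN).atTop_mul_const hq
  have hexp : Filter.Tendsto
      (fun j : ℕ => Real.exp (-((1 / 2) ^ 2 * (((2 ^ j * ⌈γ⌉₊ : ℕ) : ℝ) * q) / 2))) Filter.atTop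
      (nhds 0) :=
    Real.tendsto_exp_neg_atTop_nhds_zero.comp
      ((htend.const_mul_atTop (by norm_num)).atTop_div_const two_pos)
  -- The event lies in each single check point event, and once half the expected coverage exceeds `γ
  -- / a` the lower tail applies.
  refine ge_of_tendsto hexp ?_
  filter_upwards [htend.eventually_ge_atTop (2 * (γ / a))] with j hj
  refine (measureReal_mono fun R hR => ?_).trans
    (measure_deg_le_le G cr hcr (2 ^ j * ⌈γ⌉₊) T (s := 1 / 2) (by norm_num))
  have h1 : (deg (samples γ R j) T : ℝ) < γ / a := by
    rw [lt_div_iff₀ ha, mul_comm]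
    exact hR j
  have h2 : (deg (samples γ R j) T : ℝ) ≤ (1 - 1 / 2) * (((2 ^ j * ⌈γ⌉₊ : ℕ) : ℝ) * q) := by
    linarith
  exact h2

theorem measure_exists_misleading_le (G : SocialNetwork V) (cr : V → ℝ≥0) (hcr : 0 < ∑ v, cr v)
    {k : ℕ} (hkV : k ≤ Fintype.card V) {a ε δ : ℝ} (ha : a = 1 - 1 / Real.exp 1) (hε : 0 < ε)
    (hεa : ε < a) (hδ0 : 0 < δ) (hδ1 : δ < 1) (T : Finset V) (hq : 0 < G.coverProb cr hcr T) :
    (G.rrSequence cr hcr).real {R | ∃ j, Misleading G cr hcr k a ε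
      (threshold (Fintype.card V) k ε δ) T (2 ^ j * ⌈threshold (Fintype.card V) k ε δ⌉₊) R} ≤ δ := by
  have ha0 : 0 < a := hε.trans hεa
  have ha1 : a < 1 := by
    have : 0 < 1 / Real.exp 1 := by positivity
    linarith
  set L := Real.log (3 / δ) with hLdef
  have hrδ : Real.exp (-L) = δ / 3 := by
    rw [hLdef, ← Real.log_inv, Real.exp_log (by positivity), inv_div]
  have hL : 1 ≤ L := by
    rw [hLdef, Real.le_log_iff_exp_le (by positivity), le_div_iff₀ hδ0]
    nlinarith [Real.exp_one_lt_three, Real.exp_pos 1]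
  have hC : 0 ≤ Real.log ((Fintype.card V).choose k) :=
    Real.log_nonneg (by exact_mod_cast Nat.choose_pos hkV)
  set B := Real.log ((Fintype.card V).choose k) + L with hB
  have hB0 : 0 < B := by linarith
  set σ := √L with hσdef
  set τ := √(a * B) with hτdef
  set φ := (a * σ + τ) / ε with hφ
  have hthr : threshold (Fintype.card V) k ε δ = 2 * (φ ^ 2 + L) := by
    rw [threshold, hφ, hτdef, hσdef, hB, ha]
  have hσ0 : 0 < σ := Real.sqrt_pos.mpr (by linarith)
  have hτ0 : 0 < τ := Real.sqrt_pos.mpr (by positivity)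
  have hσ : σ ^ 2 = L := Real.sq_sqrt (by linarith)
  have hτ : τ ^ 2 = a * B := Real.sq_sqrt (by positivity)
  have hφ0 : 0 < φ := by positivity
  rw [hthr]
  set γ := 2 * (φ ^ 2 + L) with hγ
  have hγ0 : 0 < γ := by positivity
  have hN : 0 < ⌈γ⌉₊ := Nat.ceil_pos.mpr hγ0
  set q := G.coverProb cr hcr T
  set x := ⌈γ⌉₊ * q / (2 * φ ^ 2) with hx
  have hx0 : 0 < x := by positivity
  have hgc := le_mul_sq_of_eq_div hε hεa ha1 hσ0 hτ0 hσ (by linarith) hτ hφ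
  have hstage : ∀ j : ℕ, (G.rrSequence cr hcr).real
      {R | Misleading G cr hcr k a ε γ T (2 ^ j * ⌈γ⌉₊) R} ≤ stageBound L (2 ^ j * x) := by
    intro j
    have hxj : 2 ^ j * x = ((2 ^ j * ⌈γ⌉₊ : ℕ) : ℝ) * q / (2 * φ ^ 2) := by
      rw [hx]
      push_cast
      ring
    rw [hxj, stageBound]
    split_ifs with h
    · exact measure_misleading_le_of_lt_one G cr hcr hkV T (by positivity) hq (by linarith)
        (by linarith) (by positivity) (by linarith) hL (by linarith) h
    · exact measure_misleading_le_of_one_le G cr hcr hkV T (by positivity) hq (by linarith) hε hσ0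
        hτ0 hσ hτ hφ (not_lt.mp h)
  have hunion : {R | ∃ j, Misleading G cr hcr k a ε γ T (2 ^ j * ⌈γ⌉₊) R} =
      ⋃ j, {R | Misleading G cr hcr k a ε γ T (2 ^ j * ⌈γ⌉₊) R} := by
    ext R
    simp
  rw [measureReal_def]
  refine ENNReal.toReal_le_of_le_ofReal hδ0.le ?_
  rw [hunion]
  refine (measure_iUnion_le _).trans (ENNReal.tsum_le_of_sum_range_le fun M => ?_)
  calc _ ≤ ∑ j ∈ Finset.range M, ENNReal.ofReal (stageBound L (2 ^ j * x)) := by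
        refine Finset.sum_le_sum fun j _ => ?_
        exact (ENNReal.le_ofReal_iff_toReal_le (measure_ne_top _ _)
          (stageBound_nonneg L (by positivity))).mpr (hstage j)
    _ = ENNReal.ofReal (∑ j ∈ Finset.range M, stageBound L (2 ^ j * x)) :=
        (ENNReal.ofReal_sum_of_nonneg fun j _ => stageBound_nonneg L (by positivity)).symm
    _ ≤ ENNReal.ofReal δ := by
        refine ENNReal.ofReal_le_ofReal ?_
        have := sum_stageBound_le (by rw [hrδ]; linarith) hx0 M
        rw [hrδ] at this
        linarith

theorem threshold_pos {n k : ℕ} {ε δ : ℝ} (hδ0 : 0 < δ) (hδ1 : δ < 1) : 0 < threshold n k ε δ := by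
  have h : 0 < Real.log (3 / δ) := Real.log_pos (by rw [one_lt_div hδ0]; linarith)
  unfold threshold
  positivity

/-- Unless some check point is misleading or the process goes on forever, Targeted-IM returns a
good seed set. -/
theorem exists_targetedIMReturns (G : SocialNetwork V) (cr : V → ℝ≥0) (hcr : 0 < ∑ v, cr v)
    {k : ℕ} (hk : 1 ≤ k) {ε γ : ℝ} {greedyMC : List (Finset V) → Finset V}
    (hgreedy : IsGreedyMC k greedyMC) {T : Finset V} (hT : T.card = k) {R : ℕ → Finset V}
    (hR : ¬ ∃ j, Misleading G cr hcr k (1 - 1 / Real.exp 1) ε γ T (2 ^ j * ⌈γ⌉₊) R)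
    (hfin : ¬ ∀ j, (1 - 1 / Real.exp 1) * deg (samples γ R j) T < γ) :
    ∃ S, TargetedIMReturns γ greedyMC R S ∧
      (1 - 1 / Real.exp 1 - ε) * G.coverProb cr hcr T ≤ G.coverProb cr hcr S := by
  classical
  have hgr : ∀ j, (1 - 1 / Real.exp 1) * (deg (samples γ R j) T : ℝ) ≤
      deg (samples γ R j) (greedyMC (samples γ R j)) := fun j => (hgreedy _).mul_deg_le hk hT
  have hex : ∃ j, γ ≤ (deg (samples γ R j) (greedyMC (samples γ R j)) : ℝ) := by
    push Not at hfin
    obtain ⟨j, hj⟩ := hfin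
    exact ⟨j, hj.trans (hgr j)⟩
  refine ⟨_, ⟨Nat.find hex, fun i hi => not_le.mp (Nat.find_min hex hi), Nat.find_spec hex, rfl⟩, ?_⟩
  by_contra h
  exact hR ⟨Nat.find hex, _, (hgreedy _).card_eq, not_le.mp h, Nat.find_spec hex, hgr _⟩

end SocialNetwork

open SocialNetwork

theorem theorem1 {V : Type*} [Fintype V] [DecidableEq V] (G : SocialNetwork V)
    (cr : V → ℝ≥0) (hcr : 0 < ∑ v, cr v)
    (k : ℕ) (hk : 1 ≤ k) (hkV : k ≤ Fintype.card V)
    (ε δ : ℝ) (hε : 0 < ε) (hδ0 : 0 < δ) (hδ1 : δ < 1)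
    (greedyMC : List (Finset V) → Finset V) (hgreedy : SocialNetwork.IsGreedyMC k greedyMC)
    (Sopt : Finset V) (hopt : G.IsOptimalSeedSet cr k Sopt) :
    1 - δ ≤ (G.rrSequence cr hcr).real
      {R | ∃ S : Finset V,
        SocialNetwork.TargetedIMReturns
          (SocialNetwork.threshold (Fintype.card V) k ε δ) greedyMC R S ∧
        (1 - 1 / Real.exp 1 - ε) * G.expectedCriticality cr Sopt ≤
          G.expectedCriticality cr S} := by
  have hΩ : (0 : ℝ) < (∑ v, cr v : ℝ≥0) := by exact_mod_cast hcr
  have hq : 0 < G.coverProb cr hcr Sopt := by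
    obtain ⟨T, hT, hpos⟩ := G.exists_coverProb_pos cr hcr hk hkV
    have := hopt.2 T hT
    rw [G.expectedCriticality_eq cr hcr, G.expectedCriticality_eq cr hcr] at this
    exact hpos.trans_le (le_of_mul_le_mul_left this hΩ)
  have ha : 0 < 1 - 1 / Real.exp 1 := by
    rw [sub_pos, div_lt_one (Real.exp_pos 1)]
    exact Real.one_lt_exp_iff.mpr one_pos
  set γ := threshold (Fintype.card V) k ε δ with hγ
  have hbad : (G.rrSequence cr hcr).real {R | ∃ j, Misleading G cr hcr k (1 - 1 / Real.exp 1) ε γ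
      Sopt (2 ^ j * ⌈γ⌉₊) R} ≤ δ := by
    by_cases hεa : ε < 1 - 1 / Real.exp 1
    · exact measure_exists_misleading_le G cr hcr hkV rfl hε hεa hδ0 hδ1 Sopt hq
    -- For `ε ≥ 1 - 1/e` the target is nonpositive, so no seed set is bad.
    · have hempty : {R | ∃ j, Misleading G cr hcr k (1 - 1 / Real.exp 1) ε γ
          Sopt (2 ^ j * ⌈γ⌉₊) R} = ∅ := by
        refine Set.eq_empty_of_forall_notMem ?_
        rintro R ⟨j, S, -, hS, -⟩
        nlinarith [G.coverProb_nonneg cr hcr S]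
      rw [hempty, measureReal_empty]
      exact hδ0.le
  have hfin := measure_forall_deg_lt_eq_zero G cr hcr Sopt ha
    (threshold_pos (n := Fintype.card V) (k := k) (ε := ε) hδ0 hδ1) hq
  rw [← hγ] at hfin
  set good := {R | ∃ S : Finset V, TargetedIMReturns γ greedyMC R S ∧
    (1 - 1 / Real.exp 1 - ε) * G.expectedCriticality cr Sopt ≤ G.expectedCriticality cr S}
  have hcover : (Set.univ : Set (ℕ → Finset V)) ⊆ (good ∪
      {R | ∃ j, Misleading G cr hcr k (1 - 1 / Real.exp 1) ε γ Sopt (2 ^ j * ⌈γ⌉₊) R}) ∪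
      {R | ∀ j, (1 - 1 / Real.exp 1) * deg (samples γ R j) Sopt < γ} := by
    intro R _
    by_cases h1 : ∃ j, Misleading G cr hcr k (1 - 1 / Real.exp 1) ε γ Sopt (2 ^ j * ⌈γ⌉₊) R
    · exact Or.inl (Or.inr h1)
    by_cases h2 : ∀ j, (1 - 1 / Real.exp 1) * (deg (samples γ R j) Sopt : ℝ) < γ
    · exact Or.inr h2
    obtain ⟨S, hS, hS'⟩ := exists_targetedIMReturns G cr hcr hk hgreedy hopt.1 h1 h2
    refine Or.inl (Or.inl ⟨S, hS, ?_⟩)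
    rw [G.expectedCriticality_eq cr hcr, G.expectedCriticality_eq cr hcr]
    nlinarith [mul_le_mul_of_nonneg_left hS' hΩ.le]
  have h1 := measureReal_mono (μ := G.rrSequence cr hcr) hcover (measure_ne_top _ _)
  rw [probReal_univ] at h1
  have h2 := measureReal_union_le (μ := G.rrSequence cr hcr) (good ∪
      {R | ∃ j, Misleading G cr hcr k (1 - 1 / Real.exp 1) ε γ Sopt (2 ^ j * ⌈γ⌉₊) R})
      {R | ∀ j, (1 - 1 / Real.exp 1) * deg (samples γ R j) Sopt < γ}
  have h3 := measureReal_union_le (μ := G.rrSequence cr hcr) good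
      {R | ∃ j, Misleading G cr hcr k (1 - 1 / Real.exp 1) ε γ Sopt (2 ^ j * ⌈γ⌉₊) R}
  linarith
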